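/- Let $n\ge 2$ and put $\ell=4$ if $n>2$ and $\ell=5$ if $n=2$. Write $z=(x,\mathbf y,\dot{\mathbf y})\in\mathbb R^{2n+1}$ with $\mathbf y=(y^1,\dots,y^n)$, and let $J^\ell=J^\ell(\mathbb R^{2n+1},\mathbb R^n)$ be the space of $\ell$-jets of vector-functions $\mathbf f=(f^i(z))_{i=1}^n$, i.e. the real affine space with coordinates $z$ and $u^i_\alpha$ ($1\le i\le n$, $\alpha$ a multi-index in the $2n+1$ variables with $|\alpha|\le\ell$); the jet lift of $\mathbf f$ is $j^\ell\mathbf f(z)=(z,(\partial^\alpha f^i(z))_{|\alpha|\le\ell})$. There exists a set $\mathcal U\subset J^\ell$, depending only on $n$, that is open and dense, is moreover Zariski open (the complement of the common zero set of a family of polynomials in the coordinates of $J^\ell$), and meets every fibre of $J^\ell\to J^0$, $j^\ell\mathbf f(z)\mapsto(z,\mathbf f(z))$ (so that its trace on each fibre is a non-empty Zariski-open set), with the following property. Let $U\subset\mathbb R^{2n+1}$ be any open set (a coordinate domain in the spherized tangent bundle $STM$ of a manifold $M$ of dimension $n+1$) and let $\mathbf f:U\to\mathbb R^n$ be any smooth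 map with $j^\ell\mathbf f(U)\cap\mathcal U\ne\emptyset$. Then the path structure $$\ddot y^i=f^i(x,\mathbf y,\dot{\mathbf y}),\qquad 1\le i\le n,$$ is not variational on $U$ via a first-order Lagrangian: there is no smooth function $L=L(x,\mathbf y,\dot{\mathbf y})$ on $U$ such that a smooth curve $x\mapsto(x,\mathbf y(x))$, defined on an open interval and with $(x,\mathbf y(x),\dot{\mathbf y}(x))\in U$ for all $x$, is a solution of the Euler--Lagrange equations $$\frac{\partial L}{\partial y^j}-\frac{d}{dx}\frac{\partial L}{\partial\dot y^j}=0,\qquad 1\le j\le n,$$ if and only if it is a solution of the system. In particular, there is no smooth $L$ on $U$ with $\det\bigl(\partial^2L/\partial\dot y^i\partial\dot y^j\bigr)\ne0$ at every point of $U$ such that $\frac{\partial L}{\partial y^j}-\frac{d}{dx}\frac{\partial L}{\partial\dot y^j}=0$ holds identically on $U$ for all $j$, with $\frac{d}{dx}=\partial_x+\sum_j\dot y^j\partial_{y^j}+\sum_jf^j\partial_{\dot y^j}$. -/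

import Mathlib

open scoped ContDiff

namespace PathStructure

/-- Labels of the coordinates `(x, y¹, …, yⁿ, ẏ¹, …, ẏⁿ)` of `ℝ^(2n+1)`. -/
abbrev Coord (n : ℕ) : Type := Unit ⊕ (Fin n ⊕ Fin n)

/-- The coordinate `x`. -/
abbrev cx {n : ℕ} : Coord n := Sum.inl ()

/-- The coordinate `yʲ`. -/
abbrev cy {n : ℕ} (j : Fin n) : Coord n := Sum.inr (Sum.inl j)

/-- The coordinate `ẏʲ`. -/
abbrev cv {n : ℕ} (j : Fin n) : Coord n := Sum.inr (Sum.inr j)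

/-- The space `ℝ^(2n+1)` of points `z = (x, y, ẏ)`: a coordinate chart of `STM`, `dim M = n + 1`. -/
abbrev Pt (n : ℕ) : Type := Coord n → ℝ

/-- The point `(x, y, p)`. -/
def mkPt {n : ℕ} (x : ℝ) (y p : Fin n → ℝ) : Pt n :=
  Sum.elim (fun _ => x) (Sum.elim y p)

/-- The partial derivative `∂g/∂c` of a scalar function in the coordinate direction `c`. -/
noncomputable def pd {n : ℕ} (c : Coord n) (g : Pt n → ℝ) : Pt n → ℝ :=
  fun z => fderiv ℝ g z (Pi.single c 1)

/-- The iterated partial derivative `∂^α g` for a multi-index `α`: the coordinate `c` is used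
`α c` times. For a smooth `g` the order in which the coordinates are taken is irrelevant. -/
noncomputable def iterPd {n : ℕ} (α : Coord n → ℕ) (g : Pt n → ℝ) : Pt n → ℝ :=
  (Finset.univ : Finset (Coord n)).toList.foldr (fun c h => (pd c)^[α c] h) g

/-- Multi-indices in the `2n+1` independent variables, of order at most `k`. -/
abbrev MultiIndex (n k : ℕ) : Type := {α : Coord n → ℕ // ∑ c, α c ≤ k}

/-- Labels of the coordinates of `J^k(ℝ^(2n+1), ℝⁿ)`: the independent variables `c`, and the
variables `u^i_α` (`|α| ≤ k`, `1 ≤ i ≤ n`) standing for `∂^α f^i`. -/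
abbrev JetCoord (n k : ℕ) : Type := Coord n ⊕ (MultiIndex n k × Fin n)

/-- The jet space `J^k(ℝ^(2n+1), ℝⁿ)`, a finite-dimensional real affine space. -/
abbrev JetSpace (n k : ℕ) : Type := JetCoord n k → ℝ

/-- The jet lift `j^k f : z ↦ (z, (∂^α f^i (z))_{|α| ≤ k})`. -/
noncomputable def jet {n : ℕ} (k : ℕ) (f : Pt n → Fin n → ℝ) (z : Pt n) : JetSpace n k :=
  Sum.elim z (fun αi => iterPd αi.1.1 (fun w => f w αi.2) z)

/-- The zero multi-index. -/
def zeroIndex (n k : ℕ) : MultiIndex n k := ⟨fun _ => 0, by simp⟩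

/-- The fibre of `J^k → J^0` over the point `(z, u)`. -/
def jetFibre {n : ℕ} (k : ℕ) (z : Pt n) (u : Fin n → ℝ) : Set (JetSpace n k) :=
  {θ | (∀ c, θ (Sum.inl c) = z c) ∧ ∀ i, θ (Sum.inr (zeroIndex n k, i)) = u i}

/-- Zariski-open subsets of the affine space `ℝ^σ`: complements of the zero loci of sets
(equivalently, ideals) of polynomials. -/
def IsZariskiOpen {σ : Type} (S : Set (σ → ℝ)) : Prop :=
  ∃ I : Ideal (MvPolynomial σ ℝ), Sᶜ = MvPolynomial.zeroLocus ℝ I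

/-- The order `ℓ` of the jets: `5` for `n = 2`, and `4` for `n > 2`. -/
def jetOrder (n : ℕ) : ℕ := if n = 2 then 5 else 4

/-- The lift `x ↦ (x, y(x), ẏ(x))` of a curve `x ↦ (x, y(x))`. -/
noncomputable def lift {n : ℕ} (y : ℝ → Fin n → ℝ) (x : ℝ) : Pt n :=
  mkPt x (y x) (deriv y x)

/-- `y` is a smooth curve over `(a, b)` all of whose lift lies in `U`. -/
def IsCurveIn {n : ℕ} (U : Set (Pt n)) (a b : ℝ) (y : ℝ → Fin n → ℝ) : Prop :=
  ContDiffOn ℝ ∞ y (Set.Ioo a b) ∧ ∀ x ∈ Set.Ioo a b, lift y x ∈ U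

/-- `y` solves `ÿ^i = f^i(x, y, ẏ)` on `(a, b)`, that is, `x ↦ (x, y(x))` is a path. -/
def IsPath {n : ℕ} (f : Pt n → Fin n → ℝ) (a b : ℝ) (y : ℝ → Fin n → ℝ) : Prop :=
  ∀ x ∈ Set.Ioo a b, deriv (deriv y) x = f (lift y x)

/-- `y` is an extremal of `∫ L(x, y, ẏ) dx` on `(a, b)`: it satisfies the Euler-Lagrange
equations `∂L/∂yʲ - d/dx (∂L/∂ẏʲ) = 0`. -/
def IsExtremal {n : ℕ} (L : Pt n → ℝ) (a b : ℝ) (y : ℝ → Fin n → ℝ) : Prop :=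
  ∀ x ∈ Set.Ioo a b, ∀ j : Fin n,
    pd (cy j) L (lift y x) - deriv (fun t => pd (cv j) L (lift y t)) x = 0

/-- The path structure `ÿ = f(x, y, ẏ)` is variational on `U` through a smooth first-order
Lagrangian `L` on `U`: among the curves in `U`, the extremals of `L` are precisely the paths. -/
def IsVariationalOn {n : ℕ} (f : Pt n → Fin n → ℝ) (U : Set (Pt n)) : Prop :=
  ∃ L : Pt n → ℝ, ContDiffOn ℝ ∞ L U ∧
    ∀ (a b : ℝ) (y : ℝ → Fin n → ℝ), IsCurveIn U a b y →
      (IsPath f a b y ↔ IsExtremal L a b y)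

/-- The total derivative along the system,
`d/dx = ∂_x + ẏʲ ∂_{yʲ} + fʲ ∂_{ẏʲ}`. -/
noncomputable def totalDeriv {n : ℕ} (f : Pt n → Fin n → ℝ) (g : Pt n → ℝ) : Pt n → ℝ :=
  fun z => pd cx g z + ∑ j, z (cv j) * pd (cy j) g z + ∑ j, f z j * pd (cv j) g z

/-- The velocity Hessian `∂²L/∂ẏⁱ∂ẏʲ`. -/
noncomputable def velHessian {n : ℕ} (L : Pt n → ℝ) (z : Pt n) : Matrix (Fin n) (Fin n) ℝ :=
  Matrix.of fun i j => pd (cv i) (pd (cv j) L) z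

/-- The form of variationality in which the Euler-Lagrange system can be solved for `ÿ`: the
Euler-Lagrange equations vanish modulo the system and the Lagrangian is nondegenerate. -/
def IsRegularlyVariationalOn {n : ℕ} (f : Pt n → Fin n → ℝ) (U : Set (Pt n)) : Prop :=
  ∃ L : Pt n → ℝ, ContDiffOn ℝ ∞ L U ∧
    (∀ z ∈ U, ∀ j : Fin n, pd (cy j) L z - totalDeriv f (pd (cv j) L) z = 0) ∧
    ∀ z ∈ U, (velHessian L z).det ≠ 0

end PathStructure

namespace PathStructure

variable {n : ℕ}

/-! ### Partial derivatives of smooth functions on open sets -/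

/-! Let D be the total derivative, A the velocity Hessian of a Lagrangian, F = ∂f/∂ẏ, G = ∂f/∂y. A
path passes through every point, so for a variational f the Euler-Lagrange expressions vanish
identically modulo the system. Differentiating these identities gives the Helmholtz conditions: DA =
-½(FᵀA + AF) (`matDeriv_velHessian`), and AΦ is symmetric for Φ = DF - ½F² - 2G
(`velHessian_mul_jacobiEndo_symm`). The first says that A is parallel for the dynamical covariant
derivative, so AΦ' and AΦ'' are symmetric too (`velHessian_mul_covDeriv_symm`). Where A is
invertible, Φ, Φ', Φ'' are thus self-adjoint for one nondegenerate symmetric form; reversing a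
product of such operators preserves its trace, so tr(ΦΦ'Φ'') = tr(Φ''Φ'Φ) (`obstruction_eq_zero`).

The difference of these traces is a polynomial in the 4-jet of f, and the generic set is its
nonvanishing locus. Systems linear in y, with coefficients quadratic in x, make it nonzero on every
fibre over J⁰ once n ≥ 2.

Equality of extremals and paths does not assume A invertible. But if A were singular on a whole
non-empty open set, it would have a smooth kernel field κ there, not identically zero. The
Euler-Lagrange expressions are affine in the acceleration with linear part -A, so paths of f + κ
would be extremals without all being paths of f. Hence A is invertible somewhere in every non-empty
open set (`exists_det_velHessian_ne_zero`), in particular where the obstruction is nonzero. -/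

theorem contDiffOn_pd {U : Set (Pt n)} (hU : IsOpen U) {g : Pt n → ℝ}
    (hg : ContDiffOn ℝ ∞ g U) (c : Coord n) : ContDiffOn ℝ ∞ (pd c g) U :=
  (hg.fderiv_of_isOpen hU (by simp)).clm_apply contDiffOn_const

theorem differentiableAt_of_contDiffOn {U : Set (Pt n)} (hU : IsOpen U) {g : Pt n → ℝ}
    (hg : ContDiffOn ℝ ∞ g U) {z : Pt n} (hz : z ∈ U) : DifferentiableAt ℝ g z :=
  (hg.contDiffAt (hU.mem_nhds hz)).differentiableAt (by simp)

theorem contDiffOn_component {U : Set (Pt n)} {f : Pt n → Fin n → ℝ}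
    (hf : ContDiffOn ℝ ∞ f U) (i : Fin n) : ContDiffOn ℝ ∞ (fun w => f w i) U :=
  contDiffOn_pi.1 hf i

theorem contDiffOn_coord (U : Set (Pt n)) (c : Coord n) :
    ContDiffOn ℝ ∞ (fun w : Pt n => w c) U :=
  (contDiff_apply ℝ ℝ c).contDiffOn

theorem eqOn_pd {U : Set (Pt n)} (hU : IsOpen U) {g h : Pt n → ℝ} (hgh : Set.EqOn g h U)
    (c : Coord n) : Set.EqOn (pd c g) (pd c h) U := fun z hz => by
  have : g =ᶠ[nhds z] h := Filter.eventuallyEq_of_mem (hU.mem_nhds hz) hgh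
  simp only [pd, this.fderiv_eq]

theorem pd_comm {U : Set (Pt n)} (hU : IsOpen U) {g : Pt n → ℝ} (hg : ContDiffOn ℝ ∞ g U)
    (c d : Coord n) : Set.EqOn (pd c (pd d g)) (pd d (pd c g)) U := fun z hz => by
  have hs : IsSymmSndFDerivAt ℝ g z :=
    (hg.contDiffAt (hU.mem_nhds hz)).isSymmSndFDerivAt
      (by simpa using WithTop.coe_le_coe.2 (le_top : (2 : ℕ∞) ≤ ⊤))
  have hd : DifferentiableAt ℝ (fderiv ℝ g) z :=
    ((hg.fderiv_of_isOpen (m := ∞) hU (by simp)).contDiffAt (hU.mem_nhds hz)).differentiableAt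
      (by simp)
  have key : ∀ a b : Coord n, pd a (pd b g) z
      = fderiv ℝ (fderiv ℝ g) z (Pi.single a 1) (Pi.single b 1) := fun a b => by
    unfold pd
    rw [fderiv_clm_apply hd (differentiableAt_const _)]
    simp
  rw [key, key]
  exact hs _ _

theorem pd_coord (c d : Coord n) (z : Pt n) :
    pd c (fun w : Pt n => w d) z = if c = d then 1 else 0 := by
  have : fderiv ℝ (fun w : Pt n => w d) z = ContinuousLinearMap.proj d :=
    (ContinuousLinearMap.proj (R := ℝ) (φ := fun _ : Coord n => ℝ) d).fderiv
  simp only [pd, this, ContinuousLinearMap.proj_apply, Pi.single_apply, eq_comm]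

theorem pd_const (c : Coord n) (a : ℝ) (z : Pt n) : pd c (fun _ => a) z = 0 := by
  simp [pd]

theorem pd_add {g h : Pt n → ℝ} {z : Pt n} (hg : DifferentiableAt ℝ g z)
    (hh : DifferentiableAt ℝ h z) (c : Coord n) :
    pd c (fun w => g w + h w) z = pd c g z + pd c h z := by
  simp only [pd, fderiv_fun_add hg hh, add_apply]

theorem pd_mul {g h : Pt n → ℝ} {z : Pt n} (hg : DifferentiableAt ℝ g z)
    (hh : DifferentiableAt ℝ h z) (c : Coord n) :
    pd c (fun w => g w * h w) z = g z * pd c h z + pd c g z * h z := by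
  simp only [pd, fderiv_fun_mul hg hh, add_apply,
    smul_apply, smul_eq_mul]
  ring

theorem pd_sum {ι : Type*} (s : Finset ι) {g : ι → Pt n → ℝ} {z : Pt n}
    (hg : ∀ i ∈ s, DifferentiableAt ℝ (g i) z) (c : Coord n) :
    pd c (fun w => ∑ i ∈ s, g i w) z = ∑ i ∈ s, pd c (g i) z := by
  simp only [pd, fderiv_fun_sum hg, sum_apply]

/-! ### The total derivative -/

theorem mkPt_eq_sum (x : ℝ) (y p : Fin n → ℝ) :
    mkPt x y p = x • Pi.single cx 1 + ∑ j, y j • Pi.single (cy j) (1 : ℝ)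
      + ∑ j, p j • Pi.single (cv j) (1 : ℝ) := by
  ext c
  rcases c with c | c | c <;>
    simp [mkPt, Pi.single_apply, Finset.sum_apply]

/-- D is a directional derivative, along the vector field of the system; the algebraic rules below
are inherited from `fderiv`. -/
theorem totalDeriv_eq_fderiv (f : Pt n → Fin n → ℝ) (g : Pt n → ℝ) (z : Pt n) :
    totalDeriv f g z = fderiv ℝ g z (mkPt 1 (fun j => z (cv j)) (f z)) := by
  simp [mkPt_eq_sum, totalDeriv, pd]

theorem contDiffOn_totalDeriv {U : Set (Pt n)} (hU : IsOpen U) {f : Pt n → Fin n → ℝ}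
    (hf : ContDiffOn ℝ ∞ f U) {g : Pt n → ℝ} (hg : ContDiffOn ℝ ∞ g U) :
    ContDiffOn ℝ ∞ (totalDeriv f g) U :=
  ((contDiffOn_pd hU hg cx).add (ContDiffOn.sum fun j _ =>
    (contDiffOn_coord U (cv j)).mul (contDiffOn_pd hU hg (cy j)))).add
    (ContDiffOn.sum fun j _ => (contDiffOn_component hf j).mul (contDiffOn_pd hU hg (cv j)))

theorem eqOn_totalDeriv {U : Set (Pt n)} (hU : IsOpen U) (f : Pt n → Fin n → ℝ)
    {g h : Pt n → ℝ} (hgh : Set.EqOn g h U) :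
    Set.EqOn (totalDeriv f g) (totalDeriv f h) U := fun z hz => by
  simp only [totalDeriv, eqOn_pd hU hgh _ hz]

theorem totalDeriv_mul (f : Pt n → Fin n → ℝ) {g h : Pt n → ℝ} {z : Pt n}
    (hg : DifferentiableAt ℝ g z) (hh : DifferentiableAt ℝ h z) :
    totalDeriv f (fun w => g w * h w) z = totalDeriv f g z * h z + g z * totalDeriv f h z := by
  simp only [totalDeriv_eq_fderiv, fderiv_fun_mul hg hh, add_apply,
    smul_apply, smul_eq_mul]
  ring

theorem totalDeriv_sum (f : Pt n → Fin n → ℝ) {ι : Type*} (s : Finset ι) {g : ι → Pt n → ℝ}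
    {z : Pt n} (hg : ∀ i ∈ s, DifferentiableAt ℝ (g i) z) :
    totalDeriv f (fun w => ∑ i ∈ s, g i w) z = ∑ i ∈ s, totalDeriv f (g i) z := by
  simp only [totalDeriv_eq_fderiv, fderiv_fun_sum hg, sum_apply]

theorem totalDeriv_sub (f : Pt n → Fin n → ℝ) {g h : Pt n → ℝ} {z : Pt n}
    (hg : DifferentiableAt ℝ g z) (hh : DifferentiableAt ℝ h z) :
    totalDeriv f (fun w => g w - h w) z = totalDeriv f g z - totalDeriv f h z := by
  simp only [totalDeriv_eq_fderiv, fderiv_fun_sub hg hh, sub_apply]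

theorem totalDeriv_const_mul (f : Pt n → Fin n → ℝ) (a : ℝ) {g : Pt n → ℝ} {z : Pt n}
    (hg : DifferentiableAt ℝ g z) :
    totalDeriv f (fun w => a * g w) z = a * totalDeriv f g z := by
  simp only [totalDeriv_eq_fderiv, fderiv_const_mul hg, smul_apply,
    smul_eq_mul]

/-- The commutator of a partial derivative with the total derivative. -/
theorem pd_totalDeriv {U : Set (Pt n)} (hU : IsOpen U) {f : Pt n → Fin n → ℝ}
    (hf : ContDiffOn ℝ ∞ f U) {g : Pt n → ℝ} (hg : ContDiffOn ℝ ∞ g U) (c : Coord n)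
    {z : Pt n} (hz : z ∈ U) :
    pd c (totalDeriv f g) z = totalDeriv f (pd c g) z
      + ∑ j, (if c = cv j then 1 else 0) * pd (cy j) g z
      + ∑ j, pd c (fun w => f w j) z * pd (cv j) g z := by
  have d : ∀ {h : Pt n → ℝ}, ContDiffOn ℝ ∞ h U → DifferentiableAt ℝ h z :=
    fun h => differentiableAt_of_contDiffOn hU h hz
  have hp := fun c => d (contDiffOn_pd hU hg c)
  have hq := fun j => d (contDiffOn_coord U (cv j))
  have hr := fun j => d (contDiffOn_component hf j)
  have e : totalDeriv f g = fun w => (pd cx g w + ∑ j, w (cv j) * pd (cy j) g w)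
      + ∑ j, f w j * pd (cv j) g w := rfl
  rw [e, pd_add ((hp _).fun_add (DifferentiableAt.fun_sum fun j _ => (hq j).fun_mul (hp _)))
      (DifferentiableAt.fun_sum fun j _ => (hr j).fun_mul (hp _)),
    pd_add (hp _) (DifferentiableAt.fun_sum fun j _ => (hq j).fun_mul (hp _)),
    pd_sum _ (fun j _ => (hq j).fun_mul (hp _)), pd_sum _ (fun j _ => (hr j).fun_mul (hp _))]
  simp only [pd_mul (hq _) (hp _), pd_mul (hr _) (hp _), pd_coord, totalDeriv,
    Finset.sum_add_distrib, pd_comm hU hg c _ hz]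
  ring

/-! ### Differential polynomials in the jets -/

/-- The iterated partial derivative along a list of coordinates. -/
noncomputable def listPd (α : Coord n → ℕ) (l : List (Coord n)) (g : Pt n → ℝ) : Pt n → ℝ :=
  l.foldr (fun c h => (pd c)^[α c] h) g

theorem contDiffOn_iterate_pd {U : Set (Pt n)} (hU : IsOpen U) {g : Pt n → ℝ}
    (hg : ContDiffOn ℝ ∞ g U) (c : Coord n) (m : ℕ) : ContDiffOn ℝ ∞ ((pd c)^[m] g) U := by
  induction m with
  | zero => exact hg
  | succ m ih =>
    rw [Function.iterate_succ_apply']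
    exact contDiffOn_pd hU ih c

theorem eqOn_iterate_pd {U : Set (Pt n)} (hU : IsOpen U) {g h : Pt n → ℝ}
    (hgh : Set.EqOn g h U) (c : Coord n) (m : ℕ) :
    Set.EqOn ((pd c)^[m] g) ((pd c)^[m] h) U := by
  induction m with
  | zero => exact hgh
  | succ m ih =>
    rw [Function.iterate_succ_apply', Function.iterate_succ_apply']
    exact eqOn_pd hU ih c

theorem iterate_pd_comm {U : Set (Pt n)} (hU : IsOpen U) {g : Pt n → ℝ}
    (hg : ContDiffOn ℝ ∞ g U) (c d : Coord n) (m : ℕ) :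
    Set.EqOn ((pd c)^[m] (pd d g)) (pd d ((pd c)^[m] g)) U := by
  induction m with
  | zero => exact fun _ _ => rfl
  | succ m ih =>
    rw [Function.iterate_succ_apply', Function.iterate_succ_apply']
    exact (eqOn_pd hU ih c).trans (pd_comm hU (contDiffOn_iterate_pd hU hg c m) c d)

theorem contDiffOn_listPd {U : Set (Pt n)} (hU : IsOpen U) {g : Pt n → ℝ}
    (hg : ContDiffOn ℝ ∞ g U) (α : Coord n → ℕ) (l : List (Coord n)) :
    ContDiffOn ℝ ∞ (listPd α l g) U := by
  induction l with
  | nil => exact hg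
  | cons a l ih => exact contDiffOn_iterate_pd hU ih a _

theorem listPd_congr {α β : Coord n → ℕ} {l : List (Coord n)} (h : ∀ c ∈ l, α c = β c)
    (g : Pt n → ℝ) : listPd α l g = listPd β l g := by
  induction l with
  | nil => rfl
  | cons a l ih =>
    change (pd a)^[α a] (listPd α l g) = (pd a)^[β a] (listPd β l g)
    rw [ih fun c hc => h c (List.mem_cons_of_mem _ hc), h a List.mem_cons_self]

/-- The extra derivative is taken at the unique place of `c` in the list and then moved outwards
past the later ones by symmetry of second derivatives. -/
theorem listPd_add_single {U : Set (Pt n)} (hU : IsOpen U) {g : Pt n → ℝ}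
    (hg : ContDiffOn ℝ ∞ g U) (α : Coord n → ℕ) (c : Coord n) (l : List (Coord n))
    (hl : l.Nodup) (hc : c ∈ l) :
    Set.EqOn (listPd (α + Pi.single c 1) l g) (pd c (listPd α l g)) U := by
  induction l with
  | nil => simp at hc
  | cons a l ih =>
    have hl' := List.nodup_cons.1 hl
    change Set.EqOn ((pd a)^[(α + Pi.single c 1 : Coord n → ℕ) a] (listPd (α + Pi.single c 1) l g))
      (pd c ((pd a)^[α a] (listPd α l g))) U
    by_cases hac : a = c
    · subst hac
      have hs : (α + Pi.single a 1 : Coord n → ℕ) a = α a + 1 := by simp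
      rw [hs, Function.iterate_succ_apply', listPd_congr (β := α)]
      · exact fun _ _ => rfl
      · intro d hd
        have : d ≠ a := fun h => hl'.1 (h ▸ hd)
        simp [this]
    · have hs : (α + Pi.single c 1 : Coord n → ℕ) a = α a := by simp [hac]
      rw [hs]
      have hcl : c ∈ l := by
        rcases List.mem_cons.1 hc with h | h
        · exact absurd h.symm hac
        · exact h
      exact (eqOn_iterate_pd hU (ih hl'.2 hcl) a _).trans
        (iterate_pd_comm hU (contDiffOn_listPd hU hg α l) a c _)

theorem pd_iterPd {U : Set (Pt n)} (hU : IsOpen U) {g : Pt n → ℝ}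
    (hg : ContDiffOn ℝ ∞ g U) (α : Coord n → ℕ) (c : Coord n) :
    Set.EqOn (pd c (iterPd α g)) (iterPd (α + Pi.single c 1) g) U :=
  (listPd_add_single hU hg α c _ (Finset.nodup_toList _) (by simp)).symm

theorem contDiffOn_iterPd {U : Set (Pt n)} (hU : IsOpen U) {g : Pt n → ℝ}
    (hg : ContDiffOn ℝ ∞ g U) (α : Coord n → ℕ) : ContDiffOn ℝ ∞ (iterPd α g) U :=
  contDiffOn_listPd hU hg α _

theorem iterPd_zero (g : Pt n → ℝ) : iterPd (fun _ => 0) g = g := by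
  unfold iterPd
  generalize (Finset.univ : Finset (Coord n)).toList = l
  induction l with
  | nil => rfl
  | cons a l ih => exact ih

theorem contDiffOn_jet_apply {U : Set (Pt n)} (hU : IsOpen U) {f : Pt n → Fin n → ℝ}
    (hf : ContDiffOn ℝ ∞ f U) (k : ℕ) (s : JetCoord n k) :
    ContDiffOn ℝ ∞ (fun z => jet k f z s) U := by
  rcases s with c | ⟨α, i⟩
  · exact contDiffOn_coord U c
  · exact contDiffOn_iterPd hU (contDiffOn_component hf i) α.1

theorem contDiffOn_eval {σ : Type*} {U : Set (Pt n)} {g : Pt n → σ → ℝ}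
    (hg : ∀ s, ContDiffOn ℝ ∞ (fun z => g z s) U) (P : MvPolynomial σ ℝ) :
    ContDiffOn ℝ ∞ (fun z => MvPolynomial.eval (g z) P) U := by
  induction P using MvPolynomial.induction_on with
  | C a => simpa using contDiffOn_const
  | add P Q hP hQ => simpa using hP.add hQ
  | mul_X P s hP => simpa using hP.mul (hg s)

theorem contDiffOn_eval_jet {U : Set (Pt n)} (hU : IsOpen U) {f : Pt n → Fin n → ℝ}
    (hf : ContDiffOn ℝ ∞ f U) (k : ℕ) (P : MvPolynomial (JetCoord n k) ℝ) :
    ContDiffOn ℝ ∞ (fun z => MvPolynomial.eval (jet k f z) P) U :=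
  contDiffOn_eval (contDiffOn_jet_apply hU hf k) P

/-- `G` is a polynomial differential operator of order at most `k` in `f`. -/
def IsJetPolynomial (k : ℕ) (G : (Pt n → Fin n → ℝ) → Pt n → ℝ) : Prop :=
  ∃ P : MvPolynomial (JetCoord n k) ℝ, ∀ (U : Set (Pt n)) (f : Pt n → Fin n → ℝ),
    IsOpen U → ContDiffOn ℝ ∞ f U → ∀ z ∈ U, G f z = MvPolynomial.eval (jet k f z) P

/-! ### Closure properties of polynomial differential operators. -/

namespace IsJetPolynomial

variable {k l : ℕ} {G H : (Pt n → Fin n → ℝ) → Pt n → ℝ}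

theorem const (k : ℕ) (a : ℝ) : IsJetPolynomial (n := n) k (fun _ _ => a) :=
  ⟨MvPolynomial.C a, fun _ _ _ _ _ _ => by simp⟩

theorem coord (k : ℕ) (c : Coord n) : IsJetPolynomial k (fun _ z => z c) :=
  ⟨MvPolynomial.X (Sum.inl c), fun _ _ _ _ _ _ => by simp [jet]⟩

theorem component (k : ℕ) (i : Fin n) : IsJetPolynomial k (fun f z => f z i) :=
  ⟨MvPolynomial.X (Sum.inr (zeroIndex n k, i)), fun _ _ _ _ _ _ => by
    simp [jet, zeroIndex, iterPd_zero]⟩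

theorem add (hG : IsJetPolynomial k G) (hH : IsJetPolynomial k H) :
    IsJetPolynomial k (fun f z => G f z + H f z) := by
  obtain ⟨P, hP⟩ := hG
  obtain ⟨Q, hQ⟩ := hH
  exact ⟨P + Q, fun U f hU hf z hz => by
    simp only [hP U f hU hf z hz, hQ U f hU hf z hz, map_add]⟩

theorem mul (hG : IsJetPolynomial k G) (hH : IsJetPolynomial k H) :
    IsJetPolynomial k (fun f z => G f z * H f z) := by
  obtain ⟨P, hP⟩ := hG
  obtain ⟨Q, hQ⟩ := hH
  exact ⟨P * Q, fun U f hU hf z hz => by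
    simp only [hP U f hU hf z hz, hQ U f hU hf z hz, map_mul]⟩

theorem sub (hG : IsJetPolynomial k G) (hH : IsJetPolynomial k H) :
    IsJetPolynomial k (fun f z => G f z - H f z) := by
  have := hG.add ((const k (-1)).mul hH)
  simpa [sub_eq_add_neg] using this

theorem sum {ι : Type*} (s : Finset ι) {G : ι → (Pt n → Fin n → ℝ) → Pt n → ℝ}
    (hG : ∀ i, IsJetPolynomial k (G i)) :
    IsJetPolynomial k (fun f z => ∑ i ∈ s, G i f z) := by
  choose P hP using hG
  refine ⟨∑ i ∈ s, P i, fun U f hU hf z hz => ?_⟩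
  rw [map_sum]
  exact Finset.sum_congr rfl fun i _ => hP i U f hU hf z hz

theorem mono (hG : IsJetPolynomial k G) (hkl : k ≤ l) : IsJetPolynomial l G := by
  obtain ⟨P, hP⟩ := hG
  refine ⟨MvPolynomial.rename (Sum.map id (Prod.map
    (fun α : MultiIndex n k => (⟨α.1, α.2.trans hkl⟩ : MultiIndex n l)) id)) P,
    fun U f hU hf z hz => ?_⟩
  rw [hP U f hU hf z hz, MvPolynomial.eval_rename]
  congr 2
  ext s
  rcases s with c | ⟨α, i⟩ <;> rfl

theorem congr (hG : IsJetPolynomial k G) (h : ∀ (U : Set (Pt n)) (f : Pt n → Fin n → ℝ),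
    IsOpen U → ContDiffOn ℝ ∞ f U → ∀ z ∈ U, H f z = G f z) : IsJetPolynomial k H := by
  obtain ⟨P, hP⟩ := hG
  exact ⟨P, fun U f hU hf z hz => (h U f hU hf z hz).trans (hP U f hU hf z hz)⟩

theorem eval_jet (P : MvPolynomial (JetCoord n k) ℝ) :
    IsJetPolynomial k (fun f z => MvPolynomial.eval (jet k f z) P) :=
  ⟨P, fun _ _ _ _ _ _ => rfl⟩

theorem pd_jet_apply (s : JetCoord n k) (c : Coord n) :
    IsJetPolynomial (k + 1) (fun f => pd c (fun z => jet k f z s)) := by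
  rcases s with d | ⟨α, i⟩
  · exact (const (k + 1) (if c = d then 1 else 0)).congr fun U f hU hf z hz => pd_coord c d z
  · have hα : ∑ d, (α.1 + Pi.single c 1 : Coord n → ℕ) d ≤ k + 1 := by
      simpa [Finset.sum_add_distrib] using α.2
    refine (eval_jet (MvPolynomial.X (Sum.inr (⟨α.1 + Pi.single c 1, hα⟩, i)))).congr
      fun U f hU hf z hz => ?_
    rw [MvPolynomial.eval_X]
    exact pd_iterPd hU (contDiffOn_component hf i) α.1 c hz

/-- By the Leibniz rule it suffices to differentiate the jet coordinates, and a derivative of u^i_α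
is a jet coordinate one order higher. -/
theorem pd_eval_jet (P : MvPolynomial (JetCoord n k) ℝ) (c : Coord n) :
    IsJetPolynomial (k + 1) (fun f => pd c (fun z => MvPolynomial.eval (jet k f z) P)) := by
  induction P using MvPolynomial.induction_on with
  | C a => exact (const (k + 1) 0).congr fun U f hU hf z hz => by simp [pd_const]
  | add P Q hP hQ =>
    refine (hP.add hQ).congr fun U f hU hf z hz => ?_
    have d := fun R => differentiableAt_of_contDiffOn hU (contDiffOn_eval_jet hU hf k R) hz
    simp only [map_add]
    exact pd_add (d P) (d Q) c
  | mul_X P s hP =>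
    refine ((((eval_jet P).mono k.le_succ).mul (pd_jet_apply s c)).add
      (hP.mul ((eval_jet (MvPolynomial.X s)).mono k.le_succ))).congr fun U f hU hf z hz => ?_
    have d := differentiableAt_of_contDiffOn hU (contDiffOn_eval_jet hU hf k P) hz
    have d' := differentiableAt_of_contDiffOn hU (contDiffOn_jet_apply hU hf k s) hz
    simp only [map_mul, MvPolynomial.eval_X]
    exact pd_mul d d' c

/-- A partial derivative raises the order by at most one. -/
theorem partialDeriv (hG : IsJetPolynomial k G) (c : Coord n) :
    IsJetPolynomial (k + 1) (fun f => pd c (G f)) := by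
  obtain ⟨P, hP⟩ := hG
  exact (pd_eval_jet P c).congr fun U f hU hf z hz => eqOn_pd hU (hP U f hU hf) c hz

theorem totalDeriv (hG : IsJetPolynomial k G) :
    IsJetPolynomial (k + 1) (fun f => totalDeriv f (G f)) :=
  ((hG.partialDeriv cx).add (sum _ fun j => (coord _ (cv j)).mul (hG.partialDeriv (cy j)))).add
    (sum _ fun j => (component _ j).mul (hG.partialDeriv (cv j)))

end IsJetPolynomial

/-! ### Matrix-valued functions -/

/-- A matrix of smooth functions. -/
def SmoothMatrixOn (M : Pt n → Matrix (Fin n) (Fin n) ℝ) (U : Set (Pt n)) : Prop :=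
  ∀ i j, ContDiffOn ℝ ∞ (fun z => M z i j) U

/-- The entrywise total derivative. -/
noncomputable def matDeriv (f : Pt n → Fin n → ℝ) (M : Pt n → Matrix (Fin n) (Fin n) ℝ)
    (z : Pt n) : Matrix (Fin n) (Fin n) ℝ :=
  Matrix.of fun i j => totalDeriv f (fun w => M w i j) z

/-- The matrix `∂fⁱ/∂ẏʲ`. -/
noncomputable def velJacobian (f : Pt n → Fin n → ℝ) (z : Pt n) : Matrix (Fin n) (Fin n) ℝ :=
  Matrix.of fun i j => pd (cv j) (fun w => f w i) z

/-- The matrix `∂fⁱ/∂yʲ`. -/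
noncomputable def posJacobian (f : Pt n → Fin n → ℝ) (z : Pt n) : Matrix (Fin n) (Fin n) ℝ :=
  Matrix.of fun i j => pd (cy j) (fun w => f w i) z

/-- Twice the Jacobi endomorphism of the path structure. -/
noncomputable def jacobiEndo (f : Pt n → Fin n → ℝ) (z : Pt n) : Matrix (Fin n) (Fin n) ℝ :=
  matDeriv f (velJacobian f) z - (1 / 2 : ℝ) • (velJacobian f z * velJacobian f z)
    - (2 : ℝ) • posJacobian f z

/-- The dynamical covariant derivative of an endomorphism field. -/
noncomputable def covDeriv (f : Pt n → Fin n → ℝ) (M : Pt n → Matrix (Fin n) (Fin n) ℝ)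
    (z : Pt n) : Matrix (Fin n) (Fin n) ℝ :=
  matDeriv f M z + (1 / 2 : ℝ) • (M z * velJacobian f z - velJacobian f z * M z)

/-- The obstruction `tr (Φ Φ' Φ'') - tr (Φ'' Φ' Φ)`. -/
noncomputable def obstruction (f : Pt n → Fin n → ℝ) (z : Pt n) : ℝ :=
  (jacobiEndo f z * covDeriv f (jacobiEndo f) z
    * covDeriv f (covDeriv f (jacobiEndo f)) z).trace
  - (covDeriv f (covDeriv f (jacobiEndo f)) z * covDeriv f (jacobiEndo f) z
    * jacobiEndo f z).trace

namespace SmoothMatrixOn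

variable {U : Set (Pt n)} {f : Pt n → Fin n → ℝ} {M N : Pt n → Matrix (Fin n) (Fin n) ℝ}

theorem add (hM : SmoothMatrixOn M U) (hN : SmoothMatrixOn N U) :
    SmoothMatrixOn (fun z => M z + N z) U := fun i j => (hM i j).add (hN i j)

theorem sub (hM : SmoothMatrixOn M U) (hN : SmoothMatrixOn N U) :
    SmoothMatrixOn (fun z => M z - N z) U := fun i j => (hM i j).sub (hN i j)

theorem smul (a : ℝ) (hM : SmoothMatrixOn M U) : SmoothMatrixOn (fun z => a • M z) U :=
  fun i j => contDiffOn_const.mul (hM i j)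

theorem mul (hM : SmoothMatrixOn M U) (hN : SmoothMatrixOn N U) :
    SmoothMatrixOn (fun z => M z * N z) U := fun i j => by
  simp only [Matrix.mul_apply]
  exact ContDiffOn.sum fun k _ => (hM i k).mul (hN k j)

theorem transpose (hM : SmoothMatrixOn M U) : SmoothMatrixOn (fun z => (M z).transpose) U :=
  fun i j => hM j i

theorem matDeriv (hU : IsOpen U) (hf : ContDiffOn ℝ ∞ f U) (hM : SmoothMatrixOn M U) :
    SmoothMatrixOn (matDeriv f M) U := fun i j => contDiffOn_totalDeriv hU hf (hM i j)

theorem velJacobian (hU : IsOpen U) (hf : ContDiffOn ℝ ∞ f U) :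
    SmoothMatrixOn (velJacobian f) U :=
  fun i j => contDiffOn_pd hU (contDiffOn_component hf i) (cv j)

theorem posJacobian (hU : IsOpen U) (hf : ContDiffOn ℝ ∞ f U) :
    SmoothMatrixOn (posJacobian f) U :=
  fun i j => contDiffOn_pd hU (contDiffOn_component hf i) (cy j)

theorem jacobiEndo (hU : IsOpen U) (hf : ContDiffOn ℝ ∞ f U) :
    SmoothMatrixOn (jacobiEndo f) U :=
  (((velJacobian hU hf).matDeriv hU hf).sub
    (((velJacobian hU hf).mul (velJacobian hU hf)).smul _)).sub ((posJacobian hU hf).smul _)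

theorem covDeriv (hU : IsOpen U) (hf : ContDiffOn ℝ ∞ f U) (hM : SmoothMatrixOn M U) :
    SmoothMatrixOn (covDeriv f M) U :=
  (hM.matDeriv hU hf).add
    (((hM.mul (velJacobian hU hf)).sub ((velJacobian hU hf).mul hM)).smul _)

theorem velHessian (hU : IsOpen U) {L : Pt n → ℝ} (hL : ContDiffOn ℝ ∞ L U) :
    SmoothMatrixOn (velHessian L) U :=
  fun i j => contDiffOn_pd hU (contDiffOn_pd hU hL (cv j)) (cv i)

end SmoothMatrixOn

/-! ### Derivation rules for matrices of functions. -/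

section MatDeriv

variable {U : Set (Pt n)} {f : Pt n → Fin n → ℝ} {M N : Pt n → Matrix (Fin n) (Fin n) ℝ}

theorem matDeriv_mul (hU : IsOpen U) (hM : SmoothMatrixOn M U) (hN : SmoothMatrixOn N U)
    {z : Pt n} (hz : z ∈ U) :
    matDeriv f (fun w => M w * N w) z = matDeriv f M z * N z + M z * matDeriv f N z := by
  have d := fun {g : Pt n → ℝ} (hg : ContDiffOn ℝ ∞ g U) => differentiableAt_of_contDiffOn hU hg hz
  ext i j
  simp only [matDeriv, Matrix.mul_apply, Matrix.of_apply, Matrix.add_apply]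
  rw [totalDeriv_sum _ _ fun k _ => (d (hM i k)).fun_mul (d (hN k j)),
    ← Finset.sum_add_distrib]
  exact Finset.sum_congr rfl fun k _ => totalDeriv_mul f (d (hM i k)) (d (hN k j))

theorem matDeriv_sub (hU : IsOpen U) (hM : SmoothMatrixOn M U) (hN : SmoothMatrixOn N U)
    {z : Pt n} (hz : z ∈ U) :
    matDeriv f (fun w => M w - N w) z = matDeriv f M z - matDeriv f N z := by
  have d := fun {g : Pt n → ℝ} (hg : ContDiffOn ℝ ∞ g U) => differentiableAt_of_contDiffOn hU hg hz
  ext i j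
  exact totalDeriv_sub f (d (hM i j)) (d (hN i j))

theorem matDeriv_smul (hU : IsOpen U) (a : ℝ) (hM : SmoothMatrixOn M U)
    {z : Pt n} (hz : z ∈ U) :
    matDeriv f (fun w => a • M w) z = a • matDeriv f M z := by
  ext i j
  exact totalDeriv_const_mul f a (differentiableAt_of_contDiffOn hU (hM i j) hz)

theorem matDeriv_transpose (z : Pt n) :
    matDeriv f (fun w => (M w).transpose) z = (matDeriv f M z).transpose := rfl

theorem matDeriv_congr (hU : IsOpen U) (h : Set.EqOn M N U) {z : Pt n} (hz : z ∈ U) :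
    matDeriv f M z = matDeriv f N z := by
  ext i j
  exact eqOn_totalDeriv hU f (fun w hw => by simp only [h hw]) hz

end MatDeriv

/-! ### Consequences of the Euler-Lagrange identities -/

section EulerLagrange

open Matrix

variable {U : Set (Pt n)} {f : Pt n → Fin n → ℝ} {L : Pt n → ℝ}

theorem velHessian_transpose (hU : IsOpen U) (hL : ContDiffOn ℝ ∞ L U) {z : Pt n}
    (hz : z ∈ U) : (velHessian L z)ᵀ = velHessian L z := by
  ext i j
  exact pd_comm hU hL _ _ hz

/-- The mixed Hessian `∂²L/∂ẏⁱ∂yʲ`. -/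
noncomputable def mixedHessian (L : Pt n → ℝ) (z : Pt n) : Matrix (Fin n) (Fin n) ℝ :=
  Matrix.of fun i j => pd (cv i) (pd (cy j) L) z

variable (hU : IsOpen U) (hf : ContDiffOn ℝ ∞ f U) (hL : ContDiffOn ℝ ∞ L U)
  (hEL : ∀ z ∈ U, ∀ j : Fin n, pd (cy j) L z - totalDeriv f (pd (cv j) L) z = 0)

include hU hf hL hEL

/-- Apply ∂/∂ẏⁱ to ∂L/∂yʲ = D(∂L/∂ẏʲ). The commutator of ∂/∂ẏⁱ with D contributes ∂/∂yⁱ, giving the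
transpose, and the derivatives of f, giving FᵀA. -/
theorem mixedHessian_eq {z : Pt n} (hz : z ∈ U) :
    mixedHessian L z = matDeriv f (velHessian L) z + (mixedHessian L z)ᵀ
      + (velJacobian f z)ᵀ * velHessian L z := by
  ext i j
  have h : Set.EqOn (pd (cy j) L) (totalDeriv f (pd (cv j) L)) U :=
    fun w hw => sub_eq_zero.1 (hEL w hw j)
  have h1 := eqOn_pd hU h (cv i) hz
  rw [pd_totalDeriv hU hf (contDiffOn_pd hU hL _) _ hz] at h1
  simp only [Sum.inr.injEq, ite_mul, one_mul, zero_mul, Finset.sum_ite_eq, Finset.mem_univ,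
    if_true, pd_comm hU hL (cy i) (cv j) hz] at h1
  exact h1

/-- Both sides compute ∂²L/∂yⁱ∂yʲ, by applying ∂/∂yⁱ or ∂/∂yʲ to the Euler-Lagrange identities. -/
theorem posHessian_symm {z : Pt n} (hz : z ∈ U) (i j : Fin n) :
    totalDeriv f (fun w => mixedHessian L w j i) z
        + ((posJacobian f z)ᵀ * velHessian L z) i j
      = totalDeriv f (fun w => mixedHessian L w i j) z
        + ((posJacobian f z)ᵀ * velHessian L z) j i := by
  have key : ∀ i j : Fin n, pd (cy i) (pd (cy j) L) z
      = totalDeriv f (fun w => mixedHessian L w j i) z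
        + ((posJacobian f z)ᵀ * velHessian L z) i j := fun i j => by
    have h : Set.EqOn (pd (cy j) L) (totalDeriv f (pd (cv j) L)) U :=
      fun w hw => sub_eq_zero.1 (hEL w hw j)
    have h1 := eqOn_pd hU h (cy i) hz
    rw [pd_totalDeriv hU hf (contDiffOn_pd hU hL _) _ hz,
      eqOn_totalDeriv hU f (pd_comm hU hL (cy i) (cv j)) hz] at h1
    simp only [reduceCtorEq, Sum.inr.injEq, if_false, zero_mul, Finset.sum_const_zero,
      add_zero] at h1
    exact h1
  rw [← key, ← key, pd_comm hU hL _ _ hz]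

/-- This is the symmetric part of `mixedHessian_eq`: adding the transposed identity cancels the
mixed Hessians. -/
theorem matDeriv_velHessian {z : Pt n} (hz : z ∈ U) :
    matDeriv f (velHessian L) z = -((1 / 2 : ℝ) •
      ((velJacobian f z)ᵀ * velHessian L z + velHessian L z * velJacobian f z)) := by
  have h := mixedHessian_eq hU hf hL hEL hz
  have hA := velHessian_transpose hU hL hz
  have h2 := congrArg Matrix.transpose h
  have hD : (matDeriv f (velHessian L) z)ᵀ = matDeriv f (velHessian L) z := by
    rw [← matDeriv_transpose]
    exact matDeriv_congr hU (fun w hw => velHessian_transpose hU hL hw) hz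
  simp only [transpose_add, transpose_mul, transpose_transpose, hA, hD] at h2
  ext i j
  have e1 := Matrix.ext_iff.mpr h i j
  have e2 := Matrix.ext_iff.mpr h2 i j
  simp only [Matrix.add_apply, Matrix.neg_apply, Matrix.smul_apply, smul_eq_mul] at e1 e2 ⊢
  linarith

/-- The curl of the momenta in terms of the velocity Jacobian. -/
theorem mixedHessian_sub_transpose {z : Pt n} (hz : z ∈ U) :
    mixedHessian L z - (mixedHessian L z)ᵀ = (1 / 2 : ℝ) •
      ((velJacobian f z)ᵀ * velHessian L z - velHessian L z * velJacobian f z) := by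
  have h := mixedHessian_eq hU hf hL hEL hz
  rw [matDeriv_velHessian hU hf hL hEL hz] at h
  ext i j
  have e1 := Matrix.ext_iff.mpr h i j
  simp only [Matrix.add_apply, Matrix.neg_apply, Matrix.smul_apply, smul_eq_mul, Matrix.sub_apply] at e1 ⊢
  linarith

/-- Apply D to the curl identity. The left side becomes GᵀA - AG by `posHessian_symm`; on the right,
substituting for DA cancels the terms FᵀAF and leaves the antisymmetric part of A(DF - ½F²), up to a
factor. -/
theorem velHessian_mul_jacobiEndo_symm {z : Pt n} (hz : z ∈ U) :
    (velHessian L z * jacobiEndo f z)ᵀ = velHessian L z * jacobiEndo f z := by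
  have hA := velHessian_transpose hU hL hz
  have sF := SmoothMatrixOn.velJacobian hU hf
  have sA := SmoothMatrixOn.velHessian hU hL
  have sB : SmoothMatrixOn (mixedHessian L) U :=
    fun i j => contDiffOn_pd hU (contDiffOn_pd hU hL (cy j)) (cv i)
  have e : matDeriv f (fun w => mixedHessian L w - (mixedHessian L w)ᵀ) z
      = matDeriv f (fun w => (1 / 2 : ℝ) •
        ((velJacobian f w)ᵀ * velHessian L w - velHessian L w * velJacobian f w)) z :=
    matDeriv_congr hU (fun w hw => mixedHessian_sub_transpose hU hf hL hEL hw) hz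
  rw [matDeriv_sub hU sB sB.transpose hz,
    matDeriv_smul hU _ ((sF.transpose.mul sA).sub (sA.mul sF)) hz,
    matDeriv_sub hU (sF.transpose.mul sA) (sA.mul sF) hz, matDeriv_mul hU sF.transpose sA hz,
    matDeriv_mul hU sA sF hz, matDeriv_transpose, matDeriv_transpose,
    matDeriv_velHessian hU hf hL hEL hz] at e
  have e2 : matDeriv f (mixedHessian L) z - (matDeriv f (mixedHessian L) z)ᵀ
      = (posJacobian f z)ᵀ * velHessian L z - velHessian L z * posJacobian f z := by
    ext i j
    have h := posHessian_symm hU hf hL hEL hz i j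
    have ht : ((posJacobian f z)ᵀ * velHessian L z) j i
        = (velHessian L z * posJacobian f z) i j := by
      rw [← transpose_apply ((posJacobian f z)ᵀ * velHessian L z), transpose_mul, hA,
        transpose_transpose]
    rw [ht] at h
    simp only [matDeriv, Matrix.sub_apply, transpose_apply, of_apply] at h ⊢
    linarith
  rw [e2] at e
  simp only [jacobiEndo, transpose_mul, transpose_sub, transpose_smul, hA]
  generalize velHessian L z = A at *
  generalize velJacobian f z = F at *
  generalize posJacobian f z = G at *
  generalize matDeriv f (velJacobian f) z = D at *
  simp only [mul_neg, neg_mul, mul_add, add_mul, mul_sub, sub_mul, smul_mul_assoc,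
    mul_smul_comm, ← mul_assoc] at e ⊢
  ext i j
  have e1 := Matrix.ext_iff.mpr e i j
  simp only [Matrix.add_apply, Matrix.neg_apply, Matrix.smul_apply, smul_eq_mul, Matrix.sub_apply] at e1 ⊢
  linarith

/-- With AM symmetric, A times the covariant derivative of M equals D(AM) + ½(FᵀAM + AMF), a sum of
symmetric matrices. -/
theorem velHessian_mul_covDeriv_symm {M : Pt n → Matrix (Fin n) (Fin n) ℝ}
    (hM : SmoothMatrixOn M U) (hAM : ∀ z ∈ U, (velHessian L z * M z)ᵀ = velHessian L z * M z)
    {z : Pt n} (hz : z ∈ U) :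
    (velHessian L z * covDeriv f M z)ᵀ = velHessian L z * covDeriv f M z := by
  have hA := velHessian_transpose hU hL hz
  have sA := SmoothMatrixOn.velHessian hU hL
  have e : matDeriv f (fun w => (velHessian L w * M w)ᵀ) z
      = matDeriv f (fun w => velHessian L w * M w) z := matDeriv_congr hU hAM hz
  have h := hAM z hz
  rw [matDeriv_transpose, matDeriv_mul hU sA hM hz, matDeriv_velHessian hU hf hL hEL hz] at e
  simp only [covDeriv, transpose_mul, transpose_add, transpose_neg, transpose_sub,
    transpose_smul, transpose_transpose, hA] at e h ⊢
  generalize velHessian L z = A at *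
  generalize velJacobian f z = F at *
  generalize matDeriv f M z = D at *
  generalize M z = N at *
  have h1 : Fᵀ * Nᵀ * A = Fᵀ * A * N := by rw [mul_assoc, h, mul_assoc]
  have h2 : Nᵀ * A * F = A * N * F := by rw [h]
  simp only [mul_neg, neg_mul, mul_add, add_mul, mul_sub, sub_mul, smul_mul_assoc,
    mul_smul_comm, ← mul_assoc, h1, h2] at e ⊢
  ext i j
  have e1 := Matrix.ext_iff.mpr e i j
  simp only [Matrix.add_apply, Matrix.neg_apply, Matrix.smul_apply, smul_eq_mul, Matrix.sub_apply] at e1 ⊢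
  linarith

theorem obstruction_eq_zero {z : Pt n} (hz : z ∈ U) (hdet : (velHessian L z).det ≠ 0) :
    obstruction f z = 0 := by
  have hA := velHessian_transpose hU hL hz
  have s0 := SmoothMatrixOn.jacobiEndo hU hf
  have s1 := s0.covDeriv hU hf
  have k0 := fun w (hw : w ∈ U) => velHessian_mul_jacobiEndo_symm hU hf hL hEL hw
  have k1 := fun w (hw : w ∈ U) => velHessian_mul_covDeriv_symm hU hf hL hEL s0 k0 hw
  have h2 := velHessian_mul_covDeriv_symm hU hf hL hEL s1 k1 hz
  have h0 := k0 z hz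
  have h1 := k1 z hz
  unfold obstruction
  generalize covDeriv f (covDeriv f (jacobiEndo f)) z = R at *
  generalize covDeriv f (jacobiEndo f) z = Q at *
  generalize jacobiEndo f z = P at *
  generalize velHessian L z = A at *
  have hu : IsUnit A.det := isUnit_iff_ne_zero.2 hdet
  simp only [transpose_mul, hA] at h0 h1 h2
  -- Move A to the left through the three transposes; then (PQR)ᵀ is conjugate to RQP.
  have key : (P * Q * R)ᵀ * A = A * (R * Q * P) := by
    simp only [transpose_mul, mul_assoc, h0]
    rw [← mul_assoc Qᵀ, h1, mul_assoc, ← mul_assoc Rᵀ, h2, mul_assoc]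
  have : (P * Q * R).trace = (R * Q * P).trace := by
    rw [← trace_transpose, ← mul_nonsing_inv_cancel_right _ (P * Q * R)ᵀ hu, key, trace_mul_comm,
      ← mul_assoc, nonsing_inv_mul _ hu, one_mul]
  rw [this, sub_self]

end EulerLagrange

/-! ### The obstruction as a polynomial on the jet space -/

theorem isJetPolynomial_matDeriv {k : ℕ}
    {M : (Pt n → Fin n → ℝ) → Pt n → Matrix (Fin n) (Fin n) ℝ}
    (hM : ∀ i j, IsJetPolynomial k (fun f z => M f z i j)) (i j : Fin n) :
    IsJetPolynomial (k + 1) (fun f z => matDeriv f (M f) z i j) :=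
  (hM i j).totalDeriv

theorem isJetPolynomial_velJacobian (i j : Fin n) :
    IsJetPolynomial 1 (fun f z => velJacobian f z i j) :=
  (IsJetPolynomial.component 0 i).partialDeriv (cv j)

theorem isJetPolynomial_posJacobian (i j : Fin n) :
    IsJetPolynomial 1 (fun f z => posJacobian f z i j) :=
  (IsJetPolynomial.component 0 i).partialDeriv (cy j)

theorem isJetPolynomial_matMul {k : ℕ}
    {M N : (Pt n → Fin n → ℝ) → Pt n → Matrix (Fin n) (Fin n) ℝ}
    (hM : ∀ i j, IsJetPolynomial k (fun f z => M f z i j))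
    (hN : ∀ i j, IsJetPolynomial k (fun f z => N f z i j)) (i j : Fin n) :
    IsJetPolynomial k (fun f z => (M f z * N f z) i j) := by
  simp only [Matrix.mul_apply]
  exact IsJetPolynomial.sum _ fun l => (hM i l).mul (hN l j)

theorem isJetPolynomial_jacobiEndo (i j : Fin n) :
    IsJetPolynomial 2 (fun f z => jacobiEndo f z i j) :=
  ((isJetPolynomial_matDeriv isJetPolynomial_velJacobian i j).sub
    ((IsJetPolynomial.const 2 (1 / 2)).mul ((isJetPolynomial_matMul isJetPolynomial_velJacobian
      isJetPolynomial_velJacobian i j).mono one_le_two))).sub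
    ((IsJetPolynomial.const 2 2).mul ((isJetPolynomial_posJacobian i j).mono one_le_two))

theorem isJetPolynomial_covDeriv {k : ℕ} (hk : 1 ≤ k + 1)
    {M : (Pt n → Fin n → ℝ) → Pt n → Matrix (Fin n) (Fin n) ℝ}
    (hM : ∀ i j, IsJetPolynomial k (fun f z => M f z i j)) (i j : Fin n) :
    IsJetPolynomial (k + 1) (fun f z => covDeriv f (M f) z i j) := by
  have hM' := fun i j => (hM i j).mono k.le_succ
  have hF := fun i j => (isJetPolynomial_velJacobian (n := n) i j).mono hk
  exact (isJetPolynomial_matDeriv hM i j).add ((IsJetPolynomial.const (k + 1) (1 / 2)).mul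
    ((isJetPolynomial_matMul hM' hF i j).sub (isJetPolynomial_matMul hF hM' i j)))

/-- Φ has order 2 and each covariant derivative adds one. -/
theorem isJetPolynomial_obstruction : IsJetPolynomial (n := n) 4 obstruction := by
  have h2 := isJetPolynomial_jacobiEndo (n := n)
  have h3 := isJetPolynomial_covDeriv (by norm_num) h2
  have h4 := isJetPolynomial_covDeriv (by norm_num) h3
  have h2' := fun i j => (h2 i j).mono (show 2 ≤ 4 by norm_num)
  have h3' := fun i j => (h3 i j).mono (show 3 ≤ 4 by norm_num)
  exact (IsJetPolynomial.sum _ fun i => isJetPolynomial_matMul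
    (isJetPolynomial_matMul h2' h3') h4 i i).sub (IsJetPolynomial.sum _ fun i =>
      isJetPolynomial_matMul (isJetPolynomial_matMul h4 h3') h2' i i)

/-! ### Kernel fields of singular matrices of functions -/

theorem SmoothMatrixOn.one (U : Set (Pt n)) : SmoothMatrixOn (fun _ => 1) U :=
  fun _ _ => contDiffOn_const

theorem SmoothMatrixOn.pow {U : Set (Pt n)} {M : Pt n → Matrix (Fin n) (Fin n) ℝ}
    (hM : SmoothMatrixOn M U) (k : ℕ) : SmoothMatrixOn (fun z => M z ^ k) U := by
  induction k with
  | zero => simpa using SmoothMatrixOn.one U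
  | succ k ih => simpa only [pow_succ] using ih.mul hM

theorem SmoothMatrixOn.sum_smul {U : Set (Pt n)} {ι : Type*} (s : Finset ι) {c : ι → Pt n → ℝ}
    {M : ι → Pt n → Matrix (Fin n) (Fin n) ℝ} (hc : ∀ i, ContDiffOn ℝ ∞ (c i) U)
    (hM : ∀ i, SmoothMatrixOn (M i) U) :
    SmoothMatrixOn (fun z => ∑ i ∈ s, c i z • M i z) U := fun a b => by
  simp only [Matrix.sum_apply, Matrix.smul_apply, smul_eq_mul]
  exact ContDiffOn.sum fun i _ => (hc i).mul (hM i a b)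

/-- The coefficients are universal polynomials in the matrix entries. -/
theorem contDiffOn_charpoly_coeff {U : Set (Pt n)} {M : Pt n → Matrix (Fin n) (Fin n) ℝ}
    (hM : SmoothMatrixOn M U) (k : ℕ) : ContDiffOn ℝ ∞ (fun z => (M z).charpoly.coeff k) U := by
  refine (contDiffOn_eval (g := fun z (p : Fin n × Fin n) => M z p.1 p.2)
    (fun p => hM p.1 p.2) ((Matrix.charpoly.univ ℝ (Fin n)).coeff k)).congr fun z _ => ?_
  have h := Matrix.charpoly.univ_map_eval₂Hom (Fin n) (RingHom.id ℝ)
    (fun p : Fin n × Fin n => M z p.1 p.2)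
  have h' := congrArg (fun p => Polynomial.coeff p k) h
  rw [Polynomial.coeff_map] at h'
  exact h'.symm

/-- A smooth matrix which is singular everywhere on an open set `U` has a smooth field of kernel
vectors on `U` which is not identically zero. -/
theorem exists_kernel_field {U : Set (Pt n)} (hne : U.Nonempty)
    {A : Pt n → Matrix (Fin n) (Fin n) ℝ} (hA : SmoothMatrixOn A U)
    (hdet : ∀ z ∈ U, (A z).det = 0) :
    ∃ κ : Pt n → Fin n → ℝ, ContDiffOn ℝ ∞ κ U ∧ (∀ z ∈ U, (A z).mulVec (κ z) = 0) ∧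
      ∃ z ∈ U, κ z ≠ 0 := by
  classical
  -- The adjugate may vanish identically when the rank is below n - 1. Instead take a relation of
  -- least degree ∑ cₖ Aᵏ = 0 with smooth coefficients and leading one not identically zero;
  -- Cayley-Hamilton provides a relation.
  let S : ℕ → Prop := fun d => ∃ c : ℕ → Pt n → ℝ, (∀ k, ContDiffOn ℝ ∞ (c k) U) ∧
    (∀ z ∈ U, ∑ k ∈ Finset.range (d + 1), c k z • A z ^ k = 0) ∧ ∃ z ∈ U, c d z ≠ 0
  have hS : ∃ d, S d := by
    obtain ⟨z₀, hz₀⟩ := hne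
    refine ⟨n, fun k z => (A z).charpoly.coeff k, contDiffOn_charpoly_coeff hA, fun z _ => ?_,
      z₀, hz₀, ?_⟩
    · have h := Matrix.aeval_self_charpoly (A z)
      rwa [Polynomial.aeval_eq_sum_range, Matrix.charpoly_natDegree_eq_dim,
        Fintype.card_fin] at h
    · have h := (A z₀).charpoly_monic.coeff_natDegree
      rw [Matrix.charpoly_natDegree_eq_dim, Fintype.card_fin] at h
      simp [h]
  obtain ⟨c, hc, hsum, z₁, hz₁, hcz₁⟩ := Nat.find_spec hS
  have hmin := fun m => Nat.find_min hS (m := m)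
  generalize Nat.find hS = d at *
  have hsplit : ∀ z ∈ U, A z * ∑ k ∈ Finset.range d, c (k + 1) z • A z ^ k
      = -(c 0 z • (1 : Matrix (Fin n) (Fin n) ℝ)) := fun z hz => by
    have h := hsum z hz
    rw [Finset.sum_range_succ', pow_zero] at h
    rw [← eq_neg_of_add_eq_zero_left h, Finset.mul_sum]
    exact Finset.sum_congr rfl fun k _ => by rw [mul_smul_comm, pow_succ']
  -- Taking determinants in AN = -c₀·1 with det A = 0. Then AN = 0, while N is not identically zero
  -- by minimality, so a column of N serves as the kernel field.
  have hc0 : ∀ z ∈ U, c 0 z = 0 := fun z hz => by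
    have h := congrArg Matrix.det (hsplit z hz)
    rw [Matrix.det_mul, hdet z hz, zero_mul, ← neg_smul, Matrix.det_smul, Matrix.det_one,
      mul_one] at h
    simpa using eq_zero_of_pow_eq_zero h.symm
  rcases d with _ | e
  · exact absurd (hc0 z₁ hz₁) hcz₁
  have hN : ∃ z ∈ U, ∑ k ∈ Finset.range (e + 1), c (k + 1) z • A z ^ k ≠ 0 := by
    by_contra! hcon
    exact hmin e e.lt_succ_self ⟨fun k => c (k + 1), fun k => hc _, hcon, z₁, hz₁, hcz₁⟩
  obtain ⟨z₀, hz₀, hNz⟩ := hN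
  have hNs := SmoothMatrixOn.sum_smul (Finset.range (e + 1)) (fun k => hc (k + 1))
    (fun k => hA.pow k)
  set N : Pt n → Matrix (Fin n) (Fin n) ℝ :=
    fun z => ∑ k ∈ Finset.range (e + 1), c (k + 1) z • A z ^ k with hNdef
  obtain ⟨i, j, hij⟩ : ∃ i j, N z₀ i j ≠ 0 := by
    by_contra! hcon
    exact hNz (Matrix.ext hcon)
  refine ⟨fun z i => N z i j, contDiffOn_pi.2 fun i => hNs i j, fun z hz => ?_, z₀, hz₀,
    fun h => hij (congrFun h i)⟩
  ext i
  have h := Matrix.ext_iff.mpr (hsplit z hz) i j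
  simpa [hc0 z hz, Matrix.mul_apply, Matrix.mulVec, dotProduct] using h

/-! ### Curves -/

/-- Bootstrapping: if α is C^m, so is α' = v ∘ α, hence α is C^(m+1). -/
theorem contDiffOn_of_hasDerivAt {E : Type*} [NormedAddCommGroup E] [NormedSpace ℝ E]
    {W : Set E} {v : E → E} (hv : ContDiffOn ℝ ∞ v W) {I : Set ℝ} (hI : IsOpen I) {α : ℝ → E}
    (hα : ∀ t ∈ I, HasDerivAt α (v (α t)) t) (hW : Set.MapsTo α I W) :
    ContDiffOn ℝ ∞ α I := by
  refine contDiffOn_infty.2 fun m => ?_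
  induction m with
  | zero =>
    exact contDiffOn_zero.2 fun t ht => (hα t ht).continuousAt.continuousWithinAt
  | succ m ih =>
    push_cast
    refine (contDiffOn_succ_iff_deriv_of_isOpen hI).2
      ⟨fun t ht => (hα t ht).differentiableAt.differentiableWithinAt, by simp, ?_⟩
    exact ((hv.of_le (by exact_mod_cast le_top)).comp ih hW).congr fun t ht => (hα t ht).deriv

theorem hasDerivAt_mkPt {x : ℝ → ℝ} {y p : ℝ → Fin n → ℝ} {x' t : ℝ} {y' p' : Fin n → ℝ}
    (hx : HasDerivAt x x' t) (hy : HasDerivAt y y' t) (hp : HasDerivAt p p' t) :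
    HasDerivAt (fun t => mkPt (x t) (y t) (p t)) (mkPt x' y' p') t := by
  refine hasDerivAt_pi.2 fun c => ?_
  rcases c with c | c | c
  · exact hx
  · exact hasDerivAt_pi.1 hy c
  · exact hasDerivAt_pi.1 hp c

theorem contDiffOn_sprayField {W : Set (Pt n)} {g : Pt n → Fin n → ℝ} (hg : ContDiffOn ℝ ∞ g W) :
    ContDiffOn ℝ ∞ (fun z => mkPt 1 (fun j => z (cv j)) (g z)) W := by
  refine contDiffOn_pi.2 fun c => ?_
  rcases c with c | c | c
  · exact contDiffOn_const
  · exact contDiffOn_coord W (cv c)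
  · exact contDiffOn_component hg c

/-- Through every point of `W` there passes a path. -/
theorem exists_path {W : Set (Pt n)} (hW : IsOpen W) {g : Pt n → Fin n → ℝ}
    (hg : ContDiffOn ℝ ∞ g W) {z₀ : Pt n} (hz₀ : z₀ ∈ W) :
    ∃ (a b : ℝ) (y : ℝ → Fin n → ℝ), z₀ cx ∈ Set.Ioo a b ∧ IsCurveIn W a b y ∧ IsPath g a b y ∧
      lift y (z₀ cx) = z₀ := by
  set v : Pt n → Pt n := fun z => mkPt 1 (fun j => z (cv j)) (g z) with hv
  have hvs : ContDiffOn ℝ ∞ v W := contDiffOn_sprayField hg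
  obtain ⟨α, hα₀, ε, hε, hα⟩ :=
    ((hvs.contDiffAt (hW.mem_nhds hz₀)).of_le
      (by simp)).exists_forall_mem_closedBall_exists_eq_forall_mem_Ioo_hasDerivAt₀ (z₀ cx)
  have hcont : ContinuousAt α (z₀ cx) := (hα _ ⟨by linarith, by linarith⟩).continuousAt
  obtain ⟨δ, hδ, hδW⟩ := Metric.mem_nhds_iff.1
    (hcont.preimage_mem_nhds (hW.mem_nhds (by rwa [hα₀])))
  rw [Real.ball_eq_Ioo] at hδW
  set r := min ε δ with hr
  have hr0 : 0 < r := lt_min hε hδ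
  set I := Set.Ioo (z₀ cx - r) (z₀ cx + r) with hI
  have hmem : z₀ cx ∈ I := ⟨by linarith, by linarith⟩
  have hαI : ∀ t ∈ I, HasDerivAt α (v (α t)) t := fun t ht =>
    hα t ⟨by linarith [ht.1, min_le_left ε δ], by linarith [ht.2, min_le_left ε δ]⟩
  have hWI : Set.MapsTo α I W := fun t ht =>
    hδW ⟨by linarith [ht.1, min_le_right ε δ], by linarith [ht.2, min_le_right ε δ]⟩
  have hsm := contDiffOn_of_hasDerivAt hvs isOpen_Ioo hαI hWI
  -- The x-component moves at unit speed from `z₀ cx`, so the time of the flow is x itself and the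
  -- integral curve is a lift.
  have hx : ∀ t ∈ I, α t cx = t := by
    have hd : ∀ t ∈ I, HasDerivAt (fun s => α s cx - s) 0 t := fun t ht => by
      have := (hasDerivAt_pi.1 (hαI t ht) cx).fun_sub (hasDerivAt_id' t)
      rwa [show v (α t) cx - 1 = 0 from sub_self 1] at this
    intro t ht
    have := (isOpen_Ioo).is_const_of_deriv_eq_zero isPreconnected_Ioo
      (fun s hs => (hd s hs).differentiableAt.differentiableWithinAt)
      (fun s hs => (hd s hs).deriv) ht hmem
    simp only [hα₀, sub_self] at this
    linarith
  have hy : ∀ t ∈ I, deriv (fun s i => α s (cy i)) t = fun i => α t (cv i) := fun t ht =>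
    (hasDerivAt_pi.2 fun i => hasDerivAt_pi.1 (hαI t ht) (cy i)).deriv
  have hlift : ∀ t ∈ I, lift (fun s i => α s (cy i)) t = α t := fun t ht => by
    ext c
    rcases c with c | c | c
    · exact (hx t ht).symm
    · rfl
    · exact congrFun (hy t ht) c
  refine ⟨_, _, fun s i => α s (cy i), hmem, ⟨contDiffOn_pi.2 fun i => contDiffOn_pi.1 hsm _,
    fun t ht => by rw [hlift t ht]; exact hWI ht⟩, fun t ht => ?_, by rw [hlift _ hmem, hα₀]⟩
  have hev : deriv (fun s i => α s (cy i)) =ᶠ[nhds t] fun s i => α s (cv i) :=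
    Filter.eventuallyEq_of_mem (isOpen_Ioo.mem_nhds ht) hy
  rw [hev.deriv_eq, hlift t ht]
  exact (hasDerivAt_pi.2 fun i => hasDerivAt_pi.1 (hαI t ht) (cv i)).deriv

theorem deriv_comp_lift {U : Set (Pt n)} (hU : IsOpen U) {g : Pt n → Fin n → ℝ} {a b : ℝ}
    {y : ℝ → Fin n → ℝ} (hy : IsCurveIn U a b y) (hp : IsPath g a b y) {h : Pt n → ℝ}
    (hh : ContDiffOn ℝ ∞ h U) {x : ℝ} (hx : x ∈ Set.Ioo a b) :
    deriv (fun t => h (lift y t)) x = totalDeriv g h (lift y x) := by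
  have h1 := (contDiffOn_infty_iff_deriv_of_isOpen isOpen_Ioo).1 hy.1
  have d0 := (h1.1 x hx).differentiableAt (isOpen_Ioo.mem_nhds hx)
  have d1 := (((contDiffOn_infty_iff_deriv_of_isOpen isOpen_Ioo).1 h1.2).1 x hx).differentiableAt
    (isOpen_Ioo.mem_nhds hx)
  have hl : HasDerivAt (lift y) (mkPt 1 (deriv y x) (deriv (deriv y) x)) x :=
    hasDerivAt_mkPt (hasDerivAt_id x) d0.hasDerivAt d1.hasDerivAt
  have := (differentiableAt_of_contDiffOn hU hh (hy.2 x hx)).hasFDerivAt.comp_hasDerivAt x hl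
  rw [totalDeriv_eq_fderiv, ← hp x hx]
  exact this.deriv

/-- For a variational path structure, the Euler-Lagrange equations hold modulo the system. -/
theorem eulerLagrange_of_extremal {U : Set (Pt n)} (hU : IsOpen U) {f : Pt n → Fin n → ℝ}
    (hf : ContDiffOn ℝ ∞ f U) {L : Pt n → ℝ} (hL : ContDiffOn ℝ ∞ L U)
    (h : ∀ (a b : ℝ) (y : ℝ → Fin n → ℝ), IsCurveIn U a b y → IsPath f a b y →
      IsExtremal L a b y) {z : Pt n} (hz : z ∈ U) (j : Fin n) :
    pd (cy j) L z - totalDeriv f (pd (cv j) L) z = 0 := by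
  obtain ⟨a, b, y, hx, hy, hp, hlift⟩ := exists_path hU hf hz
  have := h a b y hy hp _ hx j
  rwa [deriv_comp_lift hU hy hp (contDiffOn_pd hU hL _) hx, hlift] at this

/-- The Hessian of the Lagrangian of a variational path structure is somewhere nondegenerate on
every non-empty open set. -/
theorem exists_det_velHessian_ne_zero {U W : Set (Pt n)} (hU : IsOpen U) (hW : IsOpen W)
    (hWU : W ⊆ U) (hne : W.Nonempty) {f : Pt n → Fin n → ℝ} (hf : ContDiffOn ℝ ∞ f U)
    {L : Pt n → ℝ} (hL : ContDiffOn ℝ ∞ L U)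
    (h : ∀ (a b : ℝ) (y : ℝ → Fin n → ℝ), IsCurveIn U a b y →
      (IsPath f a b y ↔ IsExtremal L a b y)) :
    ∃ z ∈ W, (velHessian L z).det ≠ 0 := by
  by_contra! hdet
  obtain ⟨κ, hκ, hker, z₀, hz₀, hne₀⟩ :=
    exists_kernel_field hne (SmoothMatrixOn.velHessian hW (hL.mono hWU)) hdet
  -- A path of the perturbed system f + κ through a point where κ ≠ 0. It is an extremal since κ
  -- enters only through Aκ = 0; being then a path of f too, it forces κ = 0 at that point.
  obtain ⟨a, b, y, hx, hy, hp, hlift⟩ := exists_path hW ((hf.mono hWU).add hκ) hz₀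
  have hyU : IsCurveIn U a b y := ⟨hy.1, fun x hx => hWU (hy.2 x hx)⟩
  have hext : IsExtremal L a b y := fun x hx j => by
    rw [deriv_comp_lift hU hyU hp (contDiffOn_pd hU hL _) hx]
    have hEL := eulerLagrange_of_extremal hU hf hL (fun a b y hy hp => (h a b y hy).1 hp)
      (hyU.2 x hx) j
    have hk := congrFun (hker _ (hy.2 x hx)) j
    have hs : ∑ i, κ (lift y x) i * pd (cv i) (pd (cv j) L) (lift y x) = 0 := by
      refine Eq.trans ?_ hk
      refine Finset.sum_congr rfl fun i _ => ?_
      rw [pd_comm hU hL _ _ (hyU.2 x hx), mul_comm]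
      rfl
    rw [← hEL]
    simp only [totalDeriv, Pi.add_apply, add_mul, Finset.sum_add_distrib, hs, add_zero]
  have h1 := (h a b y hyU).2 hext _ hx
  rw [hp _ hx, hlift] at h1
  exact hne₀ (by simpa using h1)

/-! ### The generic set -/

/-- A matrix polynomial in `x`, quadratic around `x₀`. -/
noncomputable def quadFamily (A B C : Matrix (Fin n) (Fin n) ℝ) (x₀ : ℝ) (z : Pt n) :
    Matrix (Fin n) (Fin n) ℝ :=
  Matrix.of fun i j => A i j + (z cx - x₀) * B i j + (z cx - x₀) ^ 2 / 2 * C i j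

theorem quadFamily_apply_self (A B C : Matrix (Fin n) (Fin n) ℝ) (z : Pt n) :
    quadFamily A B C (z cx) z = A := by
  ext i j
  simp [quadFamily]

theorem pd_comp_cx {γ : ℝ → ℝ} {γ' : ℝ} {z : Pt n} (hγ : HasDerivAt γ γ' (z cx)) (c : Coord n) :
    pd c (fun w => γ (w cx)) z = if c = cx then γ' else 0 := by
  have h := hγ.comp_hasFDerivAt z
    (ContinuousLinearMap.proj (R := ℝ) (φ := fun _ : Coord n => ℝ) cx).hasFDerivAt
  rw [pd, HasFDerivAt.fderiv (f := fun w : Pt n => γ (w cx)) h]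
  simp [Pi.single_apply, eq_comm]

theorem pd_quadFamily (A B C : Matrix (Fin n) (Fin n) ℝ) (x₀ : ℝ) (i j : Fin n) (c : Coord n)
    (z : Pt n) : pd c (fun w => quadFamily A B C x₀ w i j) z
      = if c = cx then quadFamily B C 0 x₀ z i j else 0 := by
  refine pd_comp_cx (γ := fun t => A i j + (t - x₀) * B i j + (t - x₀) ^ 2 / 2 * C i j) ?_ c
  have h := (hasDerivAt_id' (z cx)).sub_const x₀
  refine (((h.mul_const (B i j)).const_add (A i j)).fun_add
    (((h.fun_pow 2).div_const 2).mul_const (C i j))).congr_deriv ?_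
  simp [quadFamily]

theorem smoothMatrixOn_quadFamily (A B C : Matrix (Fin n) (Fin n) ℝ) (x₀ : ℝ) (U : Set (Pt n)) :
    SmoothMatrixOn (quadFamily A B C x₀) U := fun i j => by
  have h := (contDiffOn_coord U (cx (n := n))).sub (contDiffOn_const (c := x₀))
  exact (contDiffOn_const.add (h.mul contDiffOn_const)).add
    (((h.pow 2).div_const 2).mul contDiffOn_const)

/-- The family depends on x only, so D acts as d/dx and shifts the Taylor coefficients. -/
theorem matDeriv_quadFamily (f : Pt n → Fin n → ℝ) (A B C : Matrix (Fin n) (Fin n) ℝ) (x₀ : ℝ) :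
    matDeriv f (quadFamily A B C x₀) = quadFamily B C 0 x₀ := by
  funext z
  ext i j
  simp [matDeriv, totalDeriv, pd_quadFamily]

/-- The path structure `ÿ = u + (A + t B + ½ t² C) (y - y₀)`, where `t = x - x₀`. -/
noncomputable def linearModel (A B C : Matrix (Fin n) (Fin n) ℝ) (z₀ : Pt n) (u : Fin n → ℝ)
    (z : Pt n) : Fin n → ℝ := fun i =>
  u i + ∑ j, quadFamily A B C (z₀ cx) z i j * (z (cy j) - z₀ (cy j))

section LinearModel

variable (A B C : Matrix (Fin n) (Fin n) ℝ) (z₀ : Pt n) (u : Fin n → ℝ)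

theorem contDiffOn_linearModel (U : Set (Pt n)) : ContDiffOn ℝ ∞ (linearModel A B C z₀ u) U :=
  contDiffOn_pi.2 fun i => contDiffOn_const.add (ContDiffOn.sum fun j _ =>
    (smoothMatrixOn_quadFamily A B C (z₀ cx) U i j).mul
      ((contDiffOn_coord U (cy j)).sub contDiffOn_const))

theorem pd_linearModel (c : Coord n) (hc : c ≠ cx) (z : Pt n) (i : Fin n) :
    pd c (fun w => linearModel A B C z₀ u w i) z
      = ∑ j, quadFamily A B C (z₀ cx) z i j * if c = cy j then 1 else 0 := by
  have d : ∀ {g : Pt n → ℝ}, ContDiffOn ℝ ∞ g Set.univ → DifferentiableAt ℝ g z :=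
    fun h => differentiableAt_of_contDiffOn isOpen_univ h (Set.mem_univ z)
  have hq := fun j => d (smoothMatrixOn_quadFamily A B C (z₀ cx) Set.univ i j)
  have hy : ∀ j : Fin n, DifferentiableAt ℝ (fun w : Pt n => w (cy j) + -z₀ (cy j)) z :=
    fun j => (d (contDiffOn_coord _ (cy j))).fun_add (differentiableAt_const _)
  have hpy : ∀ j : Fin n, pd c (fun w : Pt n => w (cy j) + -z₀ (cy j)) z
      = if c = cy j then 1 else 0 := fun j => by
    rw [pd_add (d (contDiffOn_coord _ (cy j))) (differentiableAt_const _), pd_coord, pd_const,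
      add_zero]
  simp only [linearModel, sub_eq_add_neg (_ : ℝ) (z₀ _)]
  rw [pd_add (differentiableAt_const _)
    (DifferentiableAt.fun_sum fun j _ => (hq j).fun_mul (hy j)), pd_const, zero_add,
    pd_sum _ fun j _ => (hq j).fun_mul (hy j)]
  refine Finset.sum_congr rfl fun j _ => ?_
  rw [pd_mul (hq j) (hy j), hpy, pd_quadFamily, if_neg hc, zero_mul, add_zero]

theorem velJacobian_linearModel : velJacobian (linearModel A B C z₀ u) = 0 := by
  funext z
  ext i j
  simp [velJacobian, pd_linearModel]

theorem posJacobian_linearModel (z : Pt n) :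
    posJacobian (linearModel A B C z₀ u) z = quadFamily A B C (z₀ cx) z := by
  ext i j
  simp [posJacobian, pd_linearModel]

theorem jacobiEndo_linearModel : jacobiEndo (linearModel A B C z₀ u)
    = quadFamily ((-2 : ℝ) • A) ((-2 : ℝ) • B) ((-2 : ℝ) • C) (z₀ cx) := by
  funext z
  have h : matDeriv (linearModel A B C z₀ u) 0 z = 0 := by
    ext i j
    simp [matDeriv, totalDeriv, pd_const]
  rw [jacobiEndo, velJacobian_linearModel, posJacobian_linearModel, h]
  ext i j
  simp [quadFamily]
  ring

theorem covDeriv_linearModel (M : Pt n → Matrix (Fin n) (Fin n) ℝ) :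
    covDeriv (linearModel A B C z₀ u) M = matDeriv (linearModel A B C z₀ u) M := by
  funext z
  simp [covDeriv, velJacobian_linearModel]

/-- Here F = 0, so Φ, Φ', Φ'' at z₀ are -2A, -2B, -2C; the factor is (-2)³. -/
theorem obstruction_linearModel : obstruction (linearModel A B C z₀ u) z₀
    = -8 * ((A * B * C).trace - (C * B * A).trace) := by
  simp only [obstruction, covDeriv_linearModel, jacobiEndo_linearModel, matDeriv_quadFamily,
    quadFamily_apply_self, smul_mul_assoc, mul_smul_comm, Matrix.trace_smul, smul_eq_mul]
  ring

end LinearModel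

/-! ### Nonvanishing loci of polynomials on the jet space. -/

/-- The complement of the zero locus of a nonzero polynomial function is dense. -/
theorem dense_eval_ne_zero {σ : Type*} (P : MvPolynomial σ ℝ) {θ₁ : σ → ℝ}
    (h₁ : MvPolynomial.eval θ₁ P ≠ 0) : Dense {θ : σ → ℝ | MvPolynomial.eval θ P ≠ 0} := by
  intro θ
  -- The restriction of P to the line from θ (t = 0) to θ₁ (t = 1); it is nonzero at 1, so its
  -- non-roots accumulate at 0.
  let q : Polynomial ℝ := MvPolynomial.aeval
    (fun s => Polynomial.C (θ s) + Polynomial.X * Polynomial.C (θ₁ s - θ s)) P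
  have hq : ∀ t : ℝ, q.eval t = MvPolynomial.eval (fun s => θ s + t * (θ₁ s - θ s)) P :=
    fun t => by
      have := MvPolynomial.map_aeval
        (fun s => Polynomial.C (θ s) + Polynomial.X * Polynomial.C (θ₁ s - θ s))
        (Polynomial.evalRingHom t) P
      simp only [Polynomial.coe_evalRingHom] at this
      rw [this]
      simp only [Polynomial.eval_add, Polynomial.eval_mul, Polynomial.eval_C, Polynomial.eval_X]
      congr 1
      ext <;> simp
  have hq0 : q ≠ 0 := fun h => h₁ <| by
    have := hq 1
    simpa [h] using this.symm
  have hdense : Dense {t : ℝ | q.eval t ≠ 0} := by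
    have hd : Dense (q.rootSet ℝ)ᶜ := (Polynomial.rootSet_finite q ℝ).countable.dense_compl ℝ
    refine hd.mono ?_
    intro t ht h0
    exact ht (Polynomial.mem_rootSet.2 ⟨hq0, by simpa using h0⟩)
  have hcont : Continuous fun t : ℝ => (fun s => θ s + t * (θ₁ s - θ s) : σ → ℝ) := by fun_prop
  have h0 := mem_closure_image (x := (0 : ℝ)) hcont.continuousAt (hdense 0)
  simp only [zero_mul, add_zero] at h0
  refine closure_mono ?_ h0
  rintro _ ⟨t, ht, rfl⟩
  change MvPolynomial.eval _ P ≠ 0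
  rwa [← hq t]

theorem isZariskiOpen_eval_ne_zero {σ : Type} (P : MvPolynomial σ ℝ) :
    IsZariskiOpen {θ : σ → ℝ | MvPolynomial.eval θ P ≠ 0} := by
  refine ⟨Ideal.span {P}, ?_⟩
  rw [MvPolynomial.zeroLocus_span]
  ext θ
  simp [MvPolynomial.aeval_eq_eval]

theorem jet_mem_jetFibre (k : ℕ) (f : Pt n → Fin n → ℝ) (z : Pt n) :
    jet k f z ∈ jetFibre k z (f z) :=
  ⟨fun _ => rfl, fun i => congrFun (iterPd_zero fun w => f w i) z⟩

end PathStructure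

theorem mainTheorem1 (n : ℕ) (hn : 2 ≤ n) :
    ∃ 𝒰 : Set (PathStructure.JetSpace n (PathStructure.jetOrder n)),
      IsOpen 𝒰 ∧ Dense 𝒰 ∧ PathStructure.IsZariskiOpen 𝒰 ∧
      (∀ (z : PathStructure.Pt n) (u : Fin n → ℝ),
        (𝒰 ∩ PathStructure.jetFibre (PathStructure.jetOrder n) z u).Nonempty) ∧
      ∀ (U : Set (PathStructure.Pt n)) (f : PathStructure.Pt n → Fin n → ℝ),
        IsOpen U → ContDiffOn ℝ ∞ f U →
        ((PathStructure.jet (PathStructure.jetOrder n) f '' U) ∩ 𝒰).Nonempty →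
        ¬ PathStructure.IsVariationalOn f U ∧ ¬ PathStructure.IsRegularlyVariationalOn f U := by
  open PathStructure in
  have h4 : 4 ≤ jetOrder n := by unfold jetOrder; split_ifs <;> norm_num
  obtain ⟨P, hP⟩ := (isJetPolynomial_obstruction (n := n)).mono h4
  have hfib : ∀ (z : Pt n) (u : Fin n → ℝ),
      ({θ | MvPolynomial.eval θ P ≠ 0} ∩ jetFibre (jetOrder n) z u).Nonempty := fun z u => by
    let i : Fin n := ⟨0, by omega⟩
    let j : Fin n := ⟨1, by omega⟩
    have hij : i ≠ j := by simp [i, j]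
    -- E_ij E_ji E_ii = E_ii has trace 1, while E_ii E_ji E_ij = 0; this needs two distinct indices,
    -- hence n ≥ 2.
    let f := linearModel (Matrix.single i j 1) (Matrix.single j i 1) (Matrix.single i i 1) z u
    have hfz : f z = u := by
      funext k
      simp [f, linearModel]
    refine ⟨jet _ f z, ?_, hfz ▸ jet_mem_jetFibre _ f z⟩
    change MvPolynomial.eval _ P ≠ 0
    rw [← hP Set.univ f isOpen_univ (contDiffOn_linearModel _ _ _ _ _ _) z
      (Set.mem_univ z), obstruction_linearModel]
    simp [hij.symm]
  refine ⟨{θ | MvPolynomial.eval θ P ≠ 0},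
    isOpen_ne_fun (MvPolynomial.continuous_eval P) continuous_const, ?_,
    isZariskiOpen_eval_ne_zero P, hfib, ?_⟩
  · obtain ⟨θ₁, h₁, -⟩ := hfib 0 0
    exact dense_eval_ne_zero P h₁
  rintro U f hU hf ⟨_, ⟨z₀, hz₀, rfl⟩, hz₀P⟩
  -- The Hessian may degenerate at z₀ itself, so nondegeneracy is sought on an open set where the
  -- obstruction is nonzero.
  have hW : IsOpen (U ∩ {z | obstruction f z ≠ 0}) := by
    have hc : ContinuousOn (obstruction f) U :=
      (contDiffOn_eval_jet hU hf _ P).continuousOn.congr (hP U f hU hf)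
    exact hc.isOpen_inter_preimage hU isOpen_ne
  have hmem : z₀ ∈ U ∩ {z | obstruction f z ≠ 0} := by
    refine ⟨hz₀, ?_⟩
    change obstruction f z₀ ≠ 0
    rw [hP U f hU hf z₀ hz₀]
    exact hz₀P
  constructor
  · rintro ⟨L, hL, h⟩
    obtain ⟨z, hz, hdet⟩ :=
      exists_det_velHessian_ne_zero hU hW Set.inter_subset_left ⟨z₀, hmem⟩ hf hL h
    exact hz.2 (obstruction_eq_zero hU hf hL (fun w hw j => eulerLagrange_of_extremal hU hf hL
      (fun a b y hy hp => (h a b y hy).1 hp) hw j) hz.1 hdet)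
  · rintro ⟨L, hL, hEL, hdet⟩
    exact hmem.2 (obstruction_eq_zero hU hf hL hEL hz₀ (hdet z₀ hz₀))
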